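/- **Conventions.** A *representation* of a set $X$ is a surjective partial map $\delta:\subseteq\mathbb N^{\mathbb N}\to X$; if $\delta(p)=x$, then $p$ is a *name* of $x$. A (partial, multi-valued) *problem* $f:\subseteq(X,\delta_X)\rightrightarrows(Y,\delta_Y)$ assigns to each $x\in\mathrm{dom}(f)\subseteq X$ a set $f(x)\subseteq Y$. A *realizer* of $f$ is a partial function $F:\subseteq\mathbb N^{\mathbb N}\to\mathbb N^{\mathbb N}$ such that for every name $p$ of a point $x\in\mathrm{dom}(f)$ the value $F(p)$ is defined and is a name of an element of $f(x)$. One writes $f\leq_{\mathrm{sW}}g$ (strong Weihrauch reducibility) if there are computable $K,H:\subseteq\mathbb N^{\mathbb N}\to\mathbb N^{\mathbb N}$ such that $H\circ G\circ K$ is a realizer of $f$ for every realizer $G$ of $g$, and $f\equiv_{\mathrm{sW}}g$ if $f\leq_{\mathrm{sW}}g$ and $g\leq_{\mathrm{sW}}f$. The *jump* $f'$ of $f$ is the same multi-valued map with the input representation $\delta_X$ replaced by $\delta_X\circ\lim$, where $\lim\langle p_0,p_1,\dots\rangle:=\lim_{n\to\infty}p_n$ in $\mathbb N^{\mathbb N}$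 (product topology) and $\langle p_0,p_1,\dots\rangle\langle i,j\rangle:=p_i(j)$. Sequences $(x_i)_i$ are named by $\langle p_0,p_1,\dots\rangle$ with $p_i$ a name of $x_i$, and $n\in\mathbb N$ is named by every $p$ with $p(0)=n$. A *computable Polish space* $(X,d,\alpha)$ is a complete metric space $(X,d)$ with a dense sequence $\alpha:\mathbb N\to X$ such that $(i,j)\mapsto d(\alpha(i),\alpha(j))\in\mathbb R$ is computable; it is *perfect* if it has no isolated points. A name of $x\in X$ is a $p\in\mathbb N^{\mathbb N}$ with $\alpha(p(n))\to x$ and $d(\alpha(p(n)),\alpha(p(k)))<2^{-k}$ for all $n\geq k$. Let $(B_n)_n$ be a standard enumeration of the open balls with centres $\alpha(m)$ and rational radii (balls of radius $\leq 0$ being empty). Let $\mathcal A_-(X)$ be the set of closed subsets of $X$ where $p$ is a name of $A$ if $A=X\setminus\bigcup_i B_{p(i)}$. Let $\mathcal A_+(X)$ be the set of closed subsets of $X$ where $p$ is a name of $A$ if $p$ is a name of a sequence $(x_n)_n$ in the coproduct $X\sqcup\{\infty\}$ with $\overline{\{x_n:n\in\mathbb N\}}\cap X=A$; here $q$ is a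 name of $x\in X$ in $X\sqcup\{\infty\}$ if $q(0)=0$ and $(q(1),q(2),\dots)$ is a name of $x$, and is a name of the isolated point $\infty$ if $q(0)\neq0$. Consider the following problems. * $\mathsf{BCT}_0:\subseteq\mathcal A_-(X)^{\mathbb N}\rightrightarrows X$ and $\mathsf{BCT}_2:\subseteq\mathcal A_+(X)^{\mathbb N}\rightrightarrows X$, both defined on the sequences $(A_i)_i$ with $A_i^\circ=\emptyset$ for all $i$, with values $X\setminus\bigcup_{i}A_i$. * $\mathsf{BCT}_1:\subseteq\mathcal A_-(X)^{\mathbb N}\rightrightarrows\mathbb N$ and $\mathsf{BCT}_3:\subseteq\mathcal A_+(X)^{\mathbb N}\rightrightarrows\mathbb N$, both defined on the sequences $(A_i)_i$ with $X=\bigcup_i A_i$, with values $\{i\in\mathbb N:A_i^\circ\neq\emptyset\}$. * $\mathsf{CL}_{\mathbb N}:\subseteq\mathbb N^{\mathbb N}\rightrightarrows\mathbb N$, defined on the sequences in $\mathbb N$ that have a cluster point (in the discrete space $\mathbb N$), with values the set of cluster points. **Theorem.** For every computable perfect Polish space $X$, $$\mathsf{BCT}_0'\equiv_{\mathrm{sW}}\mathsf{BCT}_2\qquad\text{and}\qquad\mathsf{BCT}_1'\equiv_{\mathrm{sW}}\mathsf{BCT}_3\equiv_{\mathrm{sW}}\mathsf{CL}_{\mathbb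 N}.$$ -/

import Mathlib

namespace CompAnalysis

open Filter Topology

universe u v

/-! ### Computable partial functions on Baire space -/

/-- Baire space. -/
abbrev Baire : Type := ℕ → ℕ

/-- Partial recursive functionals `Φ(p, n)` of a function argument `p : ℕ → ℕ` (the oracle)
and a number argument `n`: the least class that contains the basic functions and the oracle
call `(p, n) ↦ p n` and is closed under pairing, composition, primitive recursion and
unbounded search. These are Mathlib's clauses for `Nat.Partrec`, uniformly in the oracle `p`. -/
inductive RecursiveFunctional : (Baire → ℕ →. ℕ) → Prop
  | zero : RecursiveFunctional fun _ _ => Part.some 0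
  | succ : RecursiveFunctional fun _ n => Part.some (n + 1)
  | left : RecursiveFunctional fun _ n => Part.some n.unpair.1
  | right : RecursiveFunctional fun _ n => Part.some n.unpair.2
  | oracle : RecursiveFunctional fun p n => Part.some (p n)
  | pair {Φ Ψ : Baire → ℕ →. ℕ} : RecursiveFunctional Φ → RecursiveFunctional Ψ →
      RecursiveFunctional fun p n => Nat.pair <$> Φ p n <*> Ψ p n
  | comp {Φ Ψ : Baire → ℕ →. ℕ} : RecursiveFunctional Φ → RecursiveFunctional Ψ →
      RecursiveFunctional fun p n => Ψ p n >>= Φ p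
  | prec {Φ Ψ : Baire → ℕ →. ℕ} : RecursiveFunctional Φ → RecursiveFunctional Ψ →
      RecursiveFunctional fun p => Nat.unpaired fun a n =>
        n.rec (Φ p a) fun y IH => do
          let i ← IH
          Ψ p (Nat.pair a (Nat.pair y i))
  | rfind {Φ : Baire → ℕ →. ℕ} : RecursiveFunctional Φ →
      RecursiveFunctional fun p a => Nat.rfind fun n => (fun m => decide (m = 0)) <$> Φ p (Nat.pair a n)

/-- A partial function `F :⊆ ℕ^ℕ → ℕ^ℕ` is computable if one fixed oracle program computes,
for every `p ∈ dom F`, the sequence `F p` (value by value) with oracle `p`. -/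
def ComputableFun (F : Baire →. Baire) : Prop :=
  ∃ Φ : Baire → ℕ →. ℕ, RecursiveFunctional Φ ∧ ∀ p, ∀ q ∈ F p, ∀ n, q n ∈ Φ p n

/-! ### Represented spaces -/

/-- A representation of `X`: a surjective partial map `δ :⊆ ℕ^ℕ → X`, given by its graph;
`δ.name p x` means that `p ∈ dom δ` and `δ p = x`. -/
structure Representation (X : Type u) where
  name : Baire → X → Prop
  functional : ∀ p x y, name p x → name p y → x = y
  surjective : ∀ x, ∃ p, name p x

namespace Representation

variable {X : Type u} {Y : Type v}

/-- The representation of `ℕ`: `p` is a name of `p 0`. -/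
def nat : Representation ℕ where
  name p n := p 0 = n
  functional _ _ _ h h' := h.symm.trans h'
  surjective n := ⟨fun _ => n, rfl⟩

/-- The representation of a one-point space: everything is a name. -/
def unit : Representation Unit where
  name _ _ := True
  functional _ _ _ _ _ := rfl
  surjective _ := ⟨fun _ => 0, trivial⟩

/-- The representation of the coproduct: `⟨k, p⟩ = k p(0) p(1) …` is a name of `δ p` in the first
summand if `k = 0` and of `ε p` in the second summand otherwise. -/
def coprod (δ : Representation X) (ε : Representation Y) : Representation (X ⊕ Y) where
  name p z := match z with
    | Sum.inl x => p 0 = 0 ∧ δ.name (fun n => p (n + 1)) x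
    | Sum.inr y => p 0 ≠ 0 ∧ ε.name (fun n => p (n + 1)) y
  functional p z w hz hw := by
    cases z <;> cases w <;> simp only at hz hw
    · exact congrArg _ (δ.functional _ _ _ hz.2 hw.2)
    · exact absurd hz.1 hw.1
    · exact absurd hw.1 hz.1
    · exact congrArg _ (ε.functional _ _ _ hz.2 hw.2)
  surjective z := by
    cases z with
    | inl x =>
      obtain ⟨p, hp⟩ := δ.surjective x
      exact ⟨fun n => Nat.casesOn n 0 p, rfl, hp⟩
    | inr y =>
      obtain ⟨p, hp⟩ := ε.surjective y
      exact ⟨fun n => Nat.casesOn n 1 p, Nat.one_ne_zero, hp⟩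

/-- The representation `δ^ℕ` of `X^ℕ`: `⟨p₀, p₁, …⟩`, with `⟨p₀, p₁, …⟩⟨i, j⟩ = pᵢ(j)`, is a name
of `(δ pᵢ)ᵢ`. -/
def seq (δ : Representation X) : Representation (ℕ → X) where
  name p x := ∀ i, δ.name (fun j => p (Nat.pair i j)) (x i)
  functional _ _ _ h h' := funext fun i => δ.functional _ _ _ (h i) (h' i)
  surjective x := by
    choose p hp using fun i => δ.surjective (x i)
    exact ⟨fun n => p n.unpair.1 n.unpair.2, fun i => by simpa using hp i⟩

/-- The jump `δ' = δ ∘ lim`: `⟨p₀, p₁, …⟩` is a name of `x` if the sequence `pᵢ` converges in Baire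
space (product topology) to a `δ`-name of `x`. -/
def jump (δ : Representation X) : Representation X where
  name p x := ∃ q : Baire,
    Tendsto (fun i : ℕ => (fun j => p (Nat.pair i j) : Baire)) atTop (𝓝 q) ∧ δ.name q x
  functional _ _ _ := by
    rintro ⟨q, hq, hx⟩ ⟨r, hr, hy⟩
    obtain rfl := tendsto_nhds_unique hq hr
    exact δ.functional _ _ _ hx hy
  surjective x := by
    obtain ⟨q, hq⟩ := δ.surjective x
    refine ⟨fun n => q n.unpair.2, q, ?_, hq⟩
    simp

end Representation

/-! ### Multi-valued functions on represented spaces and strong Weihrauch reducibility -/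

/-- A partial multi-valued function `f :⊆ (X, δ_X) ⇉ (Y, δ_Y)` on represented spaces;
only the values `val x` with `x ∈ dom` matter. -/
structure Problem (X : Type u) (Y : Type v) where
  source : Representation X
  target : Representation Y
  dom : Set X
  val : X → Set Y

namespace Problem

/-- `f.Realizes F`: the partial function `F` is a realizer of `f`, that is, `F p` is defined and
is a name of an element of `f x` for every name `p` of a point `x ∈ dom f`. -/
def Realizes {X : Type u} {Y : Type v} (f : Problem X Y) (F : Baire →. Baire) : Prop :=
  ∀ p x, f.source.name p x → x ∈ f.dom → ∃ q ∈ F p, ∃ y ∈ f.val x, f.target.name q y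

/-- Strong Weihrauch reducibility: there are computable `K, H :⊆ ℕ^ℕ → ℕ^ℕ` such that
`H ∘ G ∘ K` is a realizer of `f` for every realizer `G` of `g`. -/
def StrongReducible {X Y Z W : Type*} (f : Problem X Y) (g : Problem Z W) : Prop :=
  ∃ K H : Baire →. Baire, ComputableFun K ∧ ComputableFun H ∧
    ∀ G : Baire →. Baire, g.Realizes G → f.Realizes (H.comp (G.comp K))

/-- Strong Weihrauch equivalence. -/
def StrongEquiv {X Y Z W : Type*} (f : Problem X Y) (g : Problem Z W) : Prop :=
  StrongReducible f g ∧ StrongReducible g f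

/-- The jump `f'`: the same multi-valued function, with the jump of the input representation. -/
def jump {X : Type u} {Y : Type v} (f : Problem X Y) : Problem X Y :=
  { f with source := f.source.jump }

end Problem

infix:50 " ≡sW " => Problem.StrongEquiv

/-! ### Computable metric spaces -/

/-- The standard enumeration `⟨⟨a, b⟩, c⟩ ↦ (a - b) / (c + 1)` of the rational numbers. -/
def ratOf (n : ℕ) : ℚ :=
  ((n.unpair.1.unpair.1 : ℚ) - (n.unpair.1.unpair.2 : ℚ)) / ((n.unpair.2 : ℚ) + 1)

theorem ratOf_surjective : Function.Surjective ratOf := by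
  intro q
  refine ⟨Nat.pair (Nat.pair q.num.toNat (-q.num).toNat) (q.den - 1), ?_⟩
  have h1 : ((q.num.toNat : ℚ) - ((-q.num).toNat : ℚ)) = q.num := by
    have : ((q.num.toNat : ℤ) - ((-q.num).toNat : ℤ)) = q.num := by omega
    exact_mod_cast this
  have h2 : (((q.den - 1 : ℕ) : ℚ) + 1) = q.den := by
    have : q.den - 1 + 1 = q.den := Nat.sub_add_cancel q.pos
    exact_mod_cast this
  simp only [ratOf, Nat.unpair_pair]
  rw [h1, h2, Rat.num_div_den]

/-- The data that make a metric space a computable metric space: a dense sequence `α` such that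
`d ∘ (α × α) : ℕ² → ℝ` is computable, that is, rational approximations of `d (α i) (α j)` with
precision `2^(-k)` can be computed from `i, j, k`. -/
structure ComputableMetric (X : Type u) [MetricSpace X] where
  α : ℕ → X
  dense : DenseRange α
  computable_dist : ∃ f : ℕ × ℕ × ℕ → ℕ, Computable f ∧
    ∀ i j k, |((ratOf (f (i, j, k)) : ℚ) : ℝ) - dist (α i) (α j)| ≤ (1 / 2 : ℝ) ^ k

namespace ComputableMetric

variable {X : Type u} [MetricSpace X]

/-- The Cauchy representation: `p` is a name of `x` if `α (p n)` converges to `x` and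
`d (α (p n)) (α (p k)) < 2^(-k)` for all `n ≥ k`. -/
def cauchy (M : ComputableMetric X) : Representation X where
  name p x := (∀ k n, k ≤ n → dist (M.α (p n)) (M.α (p k)) < (1 / 2 : ℝ) ^ k) ∧
    Tendsto (fun n => M.α (p n)) atTop (𝓝 x)
  functional _ _ _ h h' := tendsto_nhds_unique h.2 h'.2
  surjective x := by
    have h : ∀ n : ℕ, ∃ m, dist x (M.α m) < (1 / 2 : ℝ) ^ (n + 1) := fun n =>
      M.dense.exists_dist_lt x (by positivity)
    choose p hp using h
    refine ⟨p, fun k n hkn => ?_, ?_⟩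
    · have h1 := hp n
      have h2 := hp k
      have h3 : (1 / 2 : ℝ) ^ (n + 1) ≤ (1 / 2 : ℝ) ^ (k + 1) :=
        pow_le_pow_of_le_one (by norm_num) (by norm_num) (by omega)
      have h4 := dist_triangle_left (M.α (p n)) (M.α (p k)) x
      have h5 : (1 / 2 : ℝ) ^ (k + 1) = (1 / 2 : ℝ) ^ k / 2 := by ring
      linarith
    · rw [tendsto_iff_dist_tendsto_zero]
      refine squeeze_zero (fun _ => dist_nonneg) (fun n => ?_)
        ((tendsto_pow_atTop_nhds_zero_of_lt_one (r := (1 / 2 : ℝ)) (by norm_num)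
          (by norm_num)).comp (tendsto_add_atTop_nat 1))
      rw [dist_comm]
      exact (hp n).le

/-- The rational open balls `B_⟨n,k⟩ = B(α n, k-th rational)` (empty if the radius is `≤ 0`). -/
def ratBall (M : ComputableMetric X) (m : ℕ) : Set X :=
  Metric.ball (M.α m.unpair.1) ((ratOf m.unpair.2 : ℚ) : ℝ)

/-- The negative information representation `ψ₋` of the closed subsets of `X`:
`ψ₋(p) = X \ ⋃ᵢ B_{p(i)}`. -/
def psiMinus (M : ComputableMetric X) : Representation (TopologicalSpace.Closeds X) where
  name p A := (A : Set X) = (⋃ i, M.ratBall (p i))ᶜ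
  functional _ _ _ h h' := SetLike.coe_injective (h.trans h'.symm)
  surjective A := by
    classical
    obtain ⟨z, hz⟩ := ratOf_surjective 0
    refine ⟨fun i => if M.ratBall i ⊆ (A : Set X)ᶜ then i else Nat.pair 0 z, ?_⟩
    rw [eq_comm, compl_eq_comm]
    refine Set.Subset.antisymm (fun x hx => ?_) (Set.iUnion_subset fun i => ?_)
    · obtain ⟨ε, hε, hεA⟩ := Metric.isOpen_iff.1 A.isClosed.isOpen_compl x hx
      obtain ⟨n, hn⟩ := M.dense.exists_dist_lt x (half_pos hε)
      obtain ⟨q, hq1, hq2⟩ := exists_rat_btwn hn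
      obtain ⟨k, hk⟩ := ratOf_surjective q
      have hsub : M.ratBall (Nat.pair n k) ⊆ (A : Set X)ᶜ := by
        intro y hy
        refine hεA ?_
        simp only [ratBall, Nat.unpair_pair, hk, Metric.mem_ball] at hy ⊢
        have := dist_triangle_right y x (M.α n)
        linarith
      refine Set.mem_iUnion.2 ⟨Nat.pair n k, ?_⟩
      simp only [if_pos hsub]
      simpa [ratBall, hk] using hq1
    · dsimp only
      split_ifs with h
      · exact h
      · simp [ratBall, hz]

/-- The positive information representation `ψ₊` of the closed subsets of `X`: `ψ₊(p) = A` if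
`p` is a name of a sequence `(xₙ)` in the coproduct `X ⊔ {∞}` with `closure {xₙ : n ∈ ℕ} ∩ X = A`.
The additional isolated point `∞` is the right summand. -/
def psiPlus (M : ComputableMetric X) : Representation (TopologicalSpace.Closeds X) where
  name p A := ∃ x : ℕ → X ⊕ Unit, (M.cauchy.coprod Representation.unit).seq.name p x ∧
    (Sum.inl ⁻¹' closure (Set.range x) : Set X) = A
  functional _ _ _ := by
    rintro ⟨x, hx, hA⟩ ⟨y, hy, hB⟩
    obtain rfl := Representation.functional _ _ _ _ hx hy
    exact SetLike.coe_injective (hA.symm.trans hB)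
  surjective A := by
    suffices h : ∃ x : ℕ → X ⊕ Unit, (Sum.inl ⁻¹' closure (Set.range x) : Set X) = A by
      obtain ⟨x, hx⟩ := h
      obtain ⟨p, hp⟩ := (M.cauchy.coprod Representation.unit).seq.surjective x
      exact ⟨p, x, hp, hx⟩
    have : TopologicalSpace.SeparableSpace X := ⟨⟨_, Set.countable_range M.α, M.dense⟩⟩
    have : SecondCountableTopology X := UniformSpace.secondCountable_of_separable X
    rcases (A : Set X).eq_empty_or_nonempty with hA | hA
    · refine ⟨fun _ => Sum.inr (), ?_⟩
      rw [hA]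
      ext x
      simp
    · have : Nonempty (A : Set X) := hA.to_subtype
      obtain ⟨u, hu⟩ := TopologicalSpace.exists_dense_seq (A : Set X)
      refine ⟨fun n => Sum.inl (u n : X), ?_⟩
      have h1 : Set.range (fun n => (Sum.inl (u n : X) : X ⊕ Unit)) =
          Sum.inl '' (Subtype.val '' Set.range u) := by
        rw [← Set.range_comp, ← Set.range_comp]; rfl
      rw [h1, Topology.IsClosedEmbedding.inl.closure_image_eq,
        Set.preimage_image_eq _ Sum.inl_injective]
      have h2 := A.isClosed.isClosedEmbedding_subtypeVal.closure_image_eq (Set.range u)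
      rw [h2, hu.closure_eq, Set.image_univ, Subtype.range_coe]

/-! ### The Baire category problems -/

/-- `BCT₀ :⊆ 𝒜₋(X)^ℕ ⇉ X`: given nowhere dense closed sets `Aᵢ` by negative information, find a
point outside of their union. -/
def BCT0 (M : ComputableMetric X) : Problem (ℕ → TopologicalSpace.Closeds X) X where
  source := M.psiMinus.seq
  target := M.cauchy
  dom := {A | ∀ i, interior (A i : Set X) = ∅}
  val A := (⋃ i, (A i : Set X))ᶜ

/-- `BCT₁ :⊆ 𝒜₋(X)^ℕ ⇉ ℕ`: given closed sets `Aᵢ` that cover `X` by negative information, find an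
index `i` such that `Aᵢ` has non-empty interior. -/
def BCT1 (M : ComputableMetric X) : Problem (ℕ → TopologicalSpace.Closeds X) ℕ where
  source := M.psiMinus.seq
  target := Representation.nat
  dom := {A | (⋃ i, (A i : Set X)) = Set.univ}
  val A := {i | interior (A i : Set X) ≠ ∅}

/-- `BCT₂ :⊆ 𝒜₊(X)^ℕ ⇉ X`: as `BCT₀`, with positive information on the sets. -/
def BCT2 (M : ComputableMetric X) : Problem (ℕ → TopologicalSpace.Closeds X) X where
  source := M.psiPlus.seq
  target := M.cauchy
  dom := {A | ∀ i, interior (A i : Set X) = ∅}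
  val A := (⋃ i, (A i : Set X))ᶜ

/-- `BCT₃ :⊆ 𝒜₊(X)^ℕ ⇉ ℕ`: as `BCT₁`, with positive information on the sets. -/
def BCT3 (M : ComputableMetric X) : Problem (ℕ → TopologicalSpace.Closeds X) ℕ where
  source := M.psiPlus.seq
  target := Representation.nat
  dom := {A | (⋃ i, (A i : Set X)) = Set.univ}
  val A := {i | interior (A i : Set X) ≠ ∅}

end ComputableMetric

/-- The cluster point problem `CL :⊆ X^ℕ ⇉ X` of a represented topological space: given a sequence
that has a cluster point, find one. -/
def CL {X : Type u} [TopologicalSpace X] (δ : Representation X) : Problem (ℕ → X) X where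
  source := δ.seq
  target := δ
  dom := {x | ∃ a, MapClusterPt a atTop x}
  val x := {a | MapClusterPt a atTop x}

/-- The cluster point problem of the (discrete) space `ℕ`. -/
def CLNat : Problem (ℕ → ℕ) ℕ := CL Representation.nat

end CompAnalysis

namespace CompAnalysis

open Filter Topology

/-! ### Total recursive functionals on coded types -/

namespace RecursiveFunctional

/-! Every reduction is given by total recursive functionals on names, so no partiality has to be
tracked. The second equivalence follows from the cycle `BCT1.jump` ≤ `CLNat` ≤ `BCT3` ≤ `BCT1.jump`.

From positive to negative information (`negativeInfo_name`): a ball misses the closed set iff no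
enumerated point lies in it. Finding such a point is semidecidable, so a negative name is the limit
of computable approximations.

`CLNat` ≤ `BCT3`: let the `n`-th set be the closure of all `α a` such that `n` occurs at some stage
`s ≥ a`. It is the whole space if `n` recurs, and finite otherwise; finite sets have empty interior
in a perfect space.

`BCT1.jump` ≤ `CLNat`: that a ball lies in a set given by a limit of negative names is a Π₂
property, hence expressible as "infinitely often". The Baire category theorem yields a ball inside
one of the sets, that is, a cluster point.

`BCT0.jump` ≤ `BCT2` is the main difficulty. Each set is replaced by a larger, still nowhere dense
one that can be enumerated. That a ball lies in the open complement is Σ₂ in the given data;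
bounding the existential witnesses leaves a Π₁ certificate. The points `α n` that avoid the finitely
many subballs certified up to `n` are therefore enumerable, and `nowhereDense_closure_avoiding`
shows that their closure is as required. -/

theorem of_natPartrec {f : ℕ →. ℕ} (hf : Nat.Partrec f) : RecursiveFunctional fun _ => f := by
  induction hf with
  | zero => exact zero
  | succ => exact succ
  | left => exact left
  | right => exact right
  | pair _ _ hf hg => exact pair hf hg
  | comp _ _ hf hg => exact comp hf hg
  | prec _ _ hf hg => exact prec hf hg
  | rfind _ hf => exact rfind hf

/-- Substitution of a total recursive functional for the oracle. -/
theorem subst {Φ : Baire → ℕ →. ℕ} (hΦ : RecursiveFunctional Φ) {K : Baire → Baire}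
    (hK : RecursiveFunctional fun p n => Part.some (K p n)) :
    RecursiveFunctional fun p => Φ (K p) := by
  induction hΦ with
  | zero => exact zero
  | succ => exact succ
  | left => exact left
  | right => exact right
  | oracle => exact hK
  | pair _ _ hf hg => exact pair hf hg
  | comp _ _ hf hg => exact comp hf hg
  | prec _ _ hf hg => exact prec hf hg
  | rfind _ hf => exact rfind hf

end RecursiveFunctional

open Encodable

/-- `F : ℕ^ℕ → α → σ` is computed on codes by a total recursive functional. -/
def TotalRecursive {α σ : Type*} [Primcodable α] [Primcodable σ] (F : Baire → α → σ) : Prop :=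
  ∃ G : Baire → ℕ → ℕ, (RecursiveFunctional fun p n => Part.some (G p n)) ∧
    ∀ p a, G p (encode a) = encode (F p a)

namespace TotalRecursive

variable {α β γ σ : Type*} [Primcodable α] [Primcodable β] [Primcodable γ] [Primcodable σ]

theorem recursiveFunctional {F : Baire → ℕ → ℕ} (hF : TotalRecursive F) :
    RecursiveFunctional fun p n => Part.some (F p n) := by
  obtain ⟨G, hG, h⟩ := hF
  have : G = F := by
    funext p n
    simpa using h p n
  rwa [← this]

theorem of_computable {f : α → σ} (hf : Computable f) : TotalRecursive fun _ a => f a := by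
  -- Numbers that code nothing are sent to the dummy value 0; only the values at codes matter.
  refine ⟨fun _ n => ((decode (α := α) n).map fun a => encode (f a)).getD 0, ?_, fun p a => by simp⟩
  have h : Computable fun n : ℕ => ((decode (α := α) n).map fun a => encode (f a)).getD 0 :=
    Computable.option_getD (Computable.option_map Computable.decode
      ((Computable.encode.comp (hf.comp Computable.snd)).to₂)) (Computable.const 0)
  exact RecursiveFunctional.of_natPartrec (Partrec.nat_iff.1 h)

theorem oracle : TotalRecursive fun (p : Baire) (n : ℕ) => p n :=
  ⟨fun p n => p n, RecursiveFunctional.oracle, fun p a => by simp⟩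

theorem comp {F : Baire → β → σ} {H : Baire → α → β} (hF : TotalRecursive F)
    (hH : TotalRecursive H) : TotalRecursive fun p a => F p (H p a) := by
  obtain ⟨G, hG, h⟩ := hF
  obtain ⟨G', hG', h'⟩ := hH
  refine ⟨fun p n => G p (G' p n), ?_, fun p a => by simp only [h', h]⟩
  simpa using RecursiveFunctional.comp hG hG'

theorem pair {F : Baire → α → β} {H : Baire → α → γ} (hF : TotalRecursive F)
    (hH : TotalRecursive H) : TotalRecursive fun p a => (F p a, H p a) := by
  obtain ⟨G, hG, h⟩ := hF
  obtain ⟨G', hG', h'⟩ := hH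
  refine ⟨fun p n => Nat.pair (G p n) (G' p n), ?_, fun p a => by
    simp only [h', h, encode_prod_val]⟩
  have := RecursiveFunctional.pair hG hG'
  simpa [Seq.seq, Part.map_some] using this

theorem natRec {N : Baire → α → ℕ} {B : Baire → α → σ} {S : Baire → α × ℕ × σ → σ}
    (hN : TotalRecursive N) (hB : TotalRecursive B) (hS : TotalRecursive S) :
    TotalRecursive fun p a => (N p a).rec (motive := fun _ => σ) (B p a)
      fun y ih => S p (a, y, ih) := by
  obtain ⟨GB, hGB, h⟩ := hB
  obtain ⟨GS, hGS, h'⟩ := hS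
  obtain ⟨GN, hGN, hN⟩ := hN
  have key : TotalRecursive fun p (n : ℕ) => Nat.rec (motive := fun _ => ℕ) (GB p n.unpair.1)
      (fun y ih => GS p (Nat.pair n.unpair.1 (Nat.pair y ih))) n.unpair.2 := by
    refine ⟨_, ?_, fun p n => by rw [encode_nat, encode_nat]⟩
    have := RecursiveFunctional.prec hGB hGS
    refine cast (congrArg _ ?_) this
    funext p n
    simp only [Nat.unpaired]
    generalize n.unpair.2 = m
    induction m with
    | zero => rfl
    | succ m ih => simp only [ih]; simp
  have hpair : TotalRecursive fun p (n : ℕ) => Nat.pair n (GN p n) :=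
    (of_computable (Primrec₂.natPair.to_comp)).comp
      ((of_computable Computable.id).pair ⟨GN, hGN, fun p n => by simp⟩)
  refine ⟨_, (key.comp hpair).recursiveFunctional, fun p a => ?_⟩
  simp only [Nat.unpair_pair, hN, h, encode_nat]
  generalize N p a = m
  induction m with
  | zero => rfl
  | succ m ih => simp only [ih, ← h', encode_prod_val, encode_nat]

theorem map {g : β → σ} (hg : Computable g) {F : Baire → α → β} (hF : TotalRecursive F) :
    TotalRecursive fun p a => g (F p a) :=
  (of_computable hg).comp hF

theorem map₂ {g : β → γ → σ} (hg : Computable₂ g) {F : Baire → α → β} {H : Baire → α → γ}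
    (hF : TotalRecursive F) (hH : TotalRecursive H) : TotalRecursive fun p a => g (F p a) (H p a) :=
  (of_computable hg).comp (hF.pair hH)

theorem const (s : σ) : TotalRecursive fun (_ : Baire) (_ : α) => s :=
  of_computable (Computable.const s)

theorem id : TotalRecursive fun (_ : Baire) (a : α) => a :=
  of_computable Computable.id

theorem fst {F : Baire → α → β × γ} (hF : TotalRecursive F) : TotalRecursive fun p a => (F p a).1 :=
  map Computable.fst hF

theorem snd {F : Baire → α → β × γ} (hF : TotalRecursive F) : TotalRecursive fun p a => (F p a).2 :=
  map Computable.snd hF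

section Nat

variable {F H : Baire → α → ℕ}

theorem query (hF : TotalRecursive F) : TotalRecursive fun p a => p (F p a) :=
  oracle.comp hF

theorem natPair (hF : TotalRecursive F) (hH : TotalRecursive H) :
    TotalRecursive fun p a => Nat.pair (F p a) (H p a) :=
  map₂ Primrec₂.natPair.to_comp hF hH

theorem unpairFst (hF : TotalRecursive F) : TotalRecursive fun p a => (F p a).unpair.1 :=
  map (Computable.fst.comp Computable.unpair) hF

theorem unpairSnd (hF : TotalRecursive F) : TotalRecursive fun p a => (F p a).unpair.2 :=
  map (Computable.snd.comp Computable.unpair) hF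

theorem add (hF : TotalRecursive F) (hH : TotalRecursive H) :
    TotalRecursive fun p a => F p a + H p a :=
  map₂ Primrec.nat_add.to_comp hF hH

theorem mul (hF : TotalRecursive F) (hH : TotalRecursive H) :
    TotalRecursive fun p a => F p a * H p a :=
  map₂ Primrec.nat_mul.to_comp hF hH

theorem sub (hF : TotalRecursive F) (hH : TotalRecursive H) :
    TotalRecursive fun p a => F p a - H p a :=
  map₂ Primrec.nat_sub.to_comp hF hH

theorem div (hF : TotalRecursive F) (hH : TotalRecursive H) :
    TotalRecursive fun p a => F p a / H p a :=
  map₂ Primrec.nat_div.to_comp hF hH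

theorem two_pow (hF : TotalRecursive F) : TotalRecursive fun p a => 2 ^ F p a := by
  have : (fun p a => 2 ^ F p a) = fun p a => (F p a).rec (motive := fun _ => ℕ) 1
      fun y ih => (fun (_ : Baire) (x : α × ℕ × ℕ) => 2 * x.2.2) p (a, y, ih) := by
    funext p a
    induction F p a with
    | zero => rfl
    | succ n ih => rw [pow_succ, ih]; exact mul_comm _ _
  rw [this]
  exact natRec hF (const 1) ((const 2).mul id.snd.snd)

end Nat

end TotalRecursive

/-! ### Predicates decidable relative to the oracle -/

/-- A decidable predicate, uniformly in the oracle. -/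
def TotalRecursivePred {α : Type*} [Primcodable α] (P : Baire → α → Prop) : Prop :=
  ∃ b : Baire → α → Bool, TotalRecursive b ∧ ∀ p a, b p a = true ↔ P p a

namespace TotalRecursivePred

variable {α σ : Type*} [Primcodable α] [Primcodable σ] {P Q : Baire → α → Prop}

theorem of_iff (hP : TotalRecursivePred P) (h : ∀ p a, P p a ↔ Q p a) : TotalRecursivePred Q := by
  rwa [← show P = Q from funext₂ fun p a => propext (h p a)]

/-- The decidability instance is arbitrary, so that this applies to definitions by classical case
distinction. -/
theorem ite {_ : ∀ p a, Decidable (P p a)} (hP : TotalRecursivePred P)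
    {F H : Baire → α → σ} (hF : TotalRecursive F)
    (hH : TotalRecursive H) : TotalRecursive fun p a => if P p a then F p a else H p a := by
  obtain ⟨b, hb, h⟩ := hP
  have hc : Computable fun x : Bool × σ × σ => bif x.1 then x.2.1 else x.2.2 :=
    Computable.cond Computable.fst (Computable.fst.comp Computable.snd)
      (Computable.snd.comp Computable.snd)
  simpa only [cond_eq_ite, h] using TotalRecursive.map hc (hb.pair (hF.pair hH))

theorem not (hP : TotalRecursivePred P) : TotalRecursivePred fun p a => ¬ P p a := by
  obtain ⟨b, hb, h⟩ := hP
  exact ⟨_, hb.map Primrec.not.to_comp, fun p a => by simp [← h]⟩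

theorem and (hP : TotalRecursivePred P) (hQ : TotalRecursivePred Q) :
    TotalRecursivePred fun p a => P p a ∧ Q p a := by
  obtain ⟨b, hb, h⟩ := hP
  obtain ⟨c, hc, h'⟩ := hQ
  exact ⟨_, hb.map₂ Primrec.and.to_comp hc, fun p a => by simp [← h, ← h']⟩

theorem imp (hP : TotalRecursivePred P) (hQ : TotalRecursivePred Q) :
    TotalRecursivePred fun p a => P p a → Q p a :=
  (hP.and hQ.not).not.of_iff fun p a => by tauto

theorem lt {F H : Baire → α → ℕ} (hF : TotalRecursive F) (hH : TotalRecursive H) :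
    TotalRecursivePred fun p a => F p a < H p a :=
  ⟨_, hF.map₂ Primrec.nat_lt.decide.to_comp hH, fun p a => by simp⟩

theorem le {F H : Baire → α → ℕ} (hF : TotalRecursive F) (hH : TotalRecursive H) :
    TotalRecursivePred fun p a => F p a ≤ H p a :=
  (lt hH hF).not.of_iff fun _ _ => not_lt

theorem eq {F H : Baire → α → ℕ} (hF : TotalRecursive F) (hH : TotalRecursive H) :
    TotalRecursivePred fun p a => F p a = H p a :=
  ((le hF hH).and (le hH hF)).of_iff fun _ _ => le_antisymm_iff.symm

theorem forall_lt {N : Baire → α → ℕ} {R : Baire → α → ℕ → Prop} (hN : TotalRecursive N)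
    (hR : TotalRecursivePred fun p (x : α × ℕ) => R p x.1 x.2) :
    TotalRecursivePred fun p a => ∀ i < N p a, R p a i := by
  obtain ⟨b, hb, h⟩ := hR
  refine ⟨_, TotalRecursive.natRec hN (TotalRecursive.const true)
    (TotalRecursive.id.snd.snd.map₂ Primrec.and.to_comp
      (hb.comp (TotalRecursive.id.fst.pair TotalRecursive.id.snd.fst))), fun p a => ?_⟩
  change _ ↔ ∀ i < N p a, R p a i
  induction N p a with
  | zero => simp
  | succ n ih => simp only [Bool.and_eq_true, ih, h, Nat.forall_lt_succ_right]

theorem exists_lt {N : Baire → α → ℕ} {R : Baire → α → ℕ → Prop} (hN : TotalRecursive N)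
    (hR : TotalRecursivePred fun p (x : α × ℕ) => R p x.1 x.2) :
    TotalRecursivePred fun p a => ∃ i < N p a, R p a i :=
  (forall_lt (R := fun p a i => ¬ R p a i) hN hR.not).not.of_iff fun p a => by push Not; rfl

end TotalRecursivePred

/-! ### Reductions by total recursive functionals -/

namespace Problem

/-- Strong reducibility, witnessed on the level of names by total recursive functionals. -/
def TotallyReducible {X Y Z W : Type*} (f : Problem X Y) (g : Problem Z W) : Prop :=
  ∃ K H : Baire → Baire, TotalRecursive K ∧ TotalRecursive H ∧
    ∀ p x, f.source.name p x → x ∈ f.dom → ∃ z ∈ g.dom, g.source.name (K p) z ∧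
      ∀ w ∈ g.val z, ∀ q, g.target.name q w → ∃ y ∈ f.val x, f.target.name (H q) y

variable {X Y Z W S T : Type*} {f : Problem X Y} {g : Problem Z W} {h : Problem S T}

theorem TotallyReducible.strongReducible (hfg : f.TotallyReducible g) : f.StrongReducible g := by
  obtain ⟨K, H, hK, hH, hyp⟩ := hfg
  have comp : ∀ {F : Baire → Baire}, TotalRecursive F → ComputableFun (F : Baire →. Baire) :=
    fun {F} hF => ⟨_, hF.recursiveFunctional, fun p q hq n => by
      obtain rfl : F p = q := by simpa [eq_comm] using hq
      simp⟩
  refine ⟨K, H, comp hK, comp hH, fun G hG p x hp hx => ?_⟩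
  obtain ⟨z, hz, hKz, hw⟩ := hyp p x hp hx
  obtain ⟨q, hq, w, hwz, hqw⟩ := hG _ z hKz hz
  obtain ⟨y, hy, hHy⟩ := hw w hwz q hqw
  refine ⟨H q, ?_, y, hy, hHy⟩
  exact Part.mem_bind_iff.2 ⟨q, Part.mem_bind_iff.2 ⟨K p, Part.mem_some _, hq⟩, Part.mem_some _⟩

theorem TotallyReducible.trans (hfg : f.TotallyReducible g) (hgh : g.TotallyReducible h) :
    f.TotallyReducible h := by
  obtain ⟨K, H, hK, hH, hyp⟩ := hfg
  obtain ⟨K', H', hK', hH', hyp'⟩ := hgh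
  have comp : ∀ {F F' : Baire → Baire}, TotalRecursive F → TotalRecursive F' →
      TotalRecursive fun p => F (F' p) := fun {F F'} hF hF' =>
    ⟨_, hF.recursiveFunctional.subst hF'.recursiveFunctional, fun p n => by simp⟩
  refine ⟨fun p => K' (K p), fun q => H (H' q), comp hK' hK, comp hH hH', fun p x hp hx => ?_⟩
  obtain ⟨z, hz, hKz, hw⟩ := hyp p x hp hx
  obtain ⟨s, hs, hKs, ht⟩ := hyp' _ z hKz hz
  refine ⟨s, hs, hKs, fun t ht' q hq => ?_⟩
  obtain ⟨w, hwz, hHw⟩ := ht t ht' q hq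
  exact hw w hwz _ hHw

end Problem

/-! ### Certified comparison of distances -/

/-- A code of the rational number `2^(-k)`. -/
def halfPowCode (k : ℕ) : ℕ := Nat.pair (Nat.pair 1 0) (2 ^ k - 1)

theorem ratOf_halfPowCode (k : ℕ) : ratOf (halfPowCode k) = (1 / 2) ^ k := by
  have h : 1 ≤ 2 ^ k := Nat.one_le_two_pow
  simp [ratOf, halfPowCode, Nat.cast_sub h]

theorem ratOf_zero : ratOf 0 = 0 := by
  have : (0 : ℕ) = Nat.pair (Nat.pair 0 0) 0 := by decide
  rw [this]
  simp [ratOf]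

/-- Clearing denominators and moving subtracted terms to the other side leaves only sums and
products of natural numbers. -/
theorem ratOf_add_half_pow_lt_iff (a b t : ℕ) : ratOf a + (1 / 2) ^ t < ratOf b ↔
    (a.unpair.1.unpair.1 * 2 ^ t + (a.unpair.2 + 1)) * (b.unpair.2 + 1) +
      b.unpair.1.unpair.2 * ((a.unpair.2 + 1) * 2 ^ t) <
    b.unpair.1.unpair.1 * ((a.unpair.2 + 1) * 2 ^ t) +
      a.unpair.1.unpair.2 * (2 ^ t * (b.unpair.2 + 1)) := by
  have hA : (0 : ℚ) < (a.unpair.2 : ℚ) + 1 := by positivity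
  have hB : (0 : ℚ) < (b.unpair.2 : ℚ) + 1 := by positivity
  have h2 : (0 : ℚ) < 2 ^ t := by positivity
  rw [ratOf, ratOf, ← Nat.cast_lt (α := ℚ), one_div, inv_pow, inv_eq_one_div,
    div_add_div _ _ hA.ne' h2.ne', div_lt_div_iff₀ (by positivity) hB]
  push_cast
  constructor <;> intro h <;> linarith

namespace TotalRecursivePred

theorem ratOf_add_half_pow_lt {α : Type*} [Primcodable α] {A B T : Baire → α → ℕ}
    (hA : TotalRecursive A) (hB : TotalRecursive B) (hT : TotalRecursive T) :
    TotalRecursivePred fun p x => ratOf (A p x) + (1 / 2) ^ T p x < ratOf (B p x) := by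
  have one : TotalRecursive fun (_ : Baire) (_ : α) => 1 := .const 1
  have hA2 := hA.unpairSnd.add one
  have hB2 := hB.unpairSnd.add one
  exact (lt (((hA.unpairFst.unpairFst.mul hT.two_pow).add hA2).mul hB2 |>.add
    (hB.unpairFst.unpairSnd.mul (hA2.mul hT.two_pow)))
    ((hB.unpairFst.unpairFst.mul (hA2.mul hT.two_pow)).add
    (hA.unpairFst.unpairSnd.mul (hT.two_pow.mul hB2)))).of_iff fun p x =>
      (ratOf_add_half_pow_lt_iff _ _ _).symm

end TotalRecursivePred

theorem TotalRecursive.halfPowCode {α : Type*} [Primcodable α] {F : Baire → α → ℕ}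
    (hF : TotalRecursive F) : TotalRecursive fun p a => halfPowCode (F p a) :=
  (const _).natPair (hF.two_pow.sub (const 1))

namespace ComputableMetric

variable {X : Type*} [MetricSpace X] (M : ComputableMetric X)

/-- A computable approximation of `d (α i) (α j)` with precision `2^(-k)`. -/
noncomputable def approxDist : ℕ × ℕ × ℕ → ℕ := M.computable_dist.choose

/-- The distance of `α i` and `α j` is certified to be smaller than the `b`-th rational number
with precision `2^(-t)`. -/
def CloseAt (t i j b : ℕ) : Prop :=
  ratOf (M.approxDist (i, j, t + 1)) + (1 / 2) ^ t < ratOf b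

theorem totalRecursivePred_closeAt {α : Type*} [Primcodable α] {T I J B : Baire → α → ℕ}
    (hT : TotalRecursive T) (hI : TotalRecursive I) (hJ : TotalRecursive J)
    (hB : TotalRecursive B) :
    TotalRecursivePred fun p x => M.CloseAt (T p x) (I p x) (J p x) (B p x) :=
  .ratOf_add_half_pow_lt
    (.map M.computable_dist.choose_spec.1 (hI.pair (hJ.pair (hT.add (.const 1))))) hB hT

variable {M}

/-- The approximation error uses up only half of the margin `2^(-t)`. The remaining half later
absorbs the error of a Cauchy name or the radius of a ball. -/
theorem CloseAt.dist_add_lt {t i j b : ℕ} (h : M.CloseAt t i j b) :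
    dist (M.α i) (M.α j) + (1 / 2) ^ (t + 1) < ratOf b := by
  have h1 := (abs_le.1 (M.computable_dist.choose_spec.2 i j (t + 1))).1
  have h2 : ((ratOf (M.approxDist (i, j, t + 1)) + (1 / 2) ^ t : ℚ) : ℝ) < (ratOf b : ℝ) :=
    Rat.cast_lt.2 h
  push_cast at h2
  have h3 : (1 / 2 : ℝ) ^ t = 2 * (1 / 2) ^ (t + 1) := by ring
  unfold approxDist at h2
  linarith

theorem CloseAt.dist_lt {t i j b : ℕ} (h : M.CloseAt t i j b) :
    dist (M.α i) (M.α j) < ratOf b := by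
  have := h.dist_add_lt
  have : (0 : ℝ) < (1 / 2) ^ (t + 1) := by positivity
  linarith

theorem closeAt_of_dist_add_lt {t i j b : ℕ}
    (h : dist (M.α i) (M.α j) + 2 * (1 / 2) ^ t < ratOf b) : M.CloseAt t i j b := by
  have h1 := (abs_le.1 (M.computable_dist.choose_spec.2 i j (t + 1))).2
  have h3 : (1 / 2 : ℝ) ^ t = 2 * (1 / 2) ^ (t + 1) := by ring
  have h4 : (0 : ℝ) < (1 / 2) ^ (t + 1) := by positivity
  have : ((ratOf (M.approxDist (i, j, t + 1)) + (1 / 2) ^ t : ℚ) : ℝ) < (ratOf b : ℝ) := by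
    push_cast
    unfold approxDist
    linarith
  exact Rat.cast_lt.1 this

theorem eventually_closeAt {i j b : ℕ} (h : dist (M.α i) (M.α j) < ratOf b) :
    ∀ᶠ t in atTop, M.CloseAt t i j b := by
  have h1 : Tendsto (fun t : ℕ => dist (M.α i) (M.α j) + 2 * (1 / 2 : ℝ) ^ t) atTop
      (𝓝 (dist (M.α i) (M.α j) + 2 * 0)) :=
    ((tendsto_pow_atTop_nhds_zero_of_lt_one (by norm_num) (by norm_num)).const_mul _).const_add _
  rw [mul_zero, add_zero] at h1
  filter_upwards [h1.eventually_lt_const h] with t ht using closeAt_of_dist_add_lt ht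

/-! ### Names and the dense sequence -/

theorem cauchy_const (M : ComputableMetric X) (n : ℕ) : M.cauchy.name (fun _ => n) (M.α n) :=
  ⟨fun k m _ => by simp, tendsto_const_nhds⟩

theorem dist_le_of_cauchy_name {p : Baire} {x : X} (h : M.cauchy.name p x) (k : ℕ) :
    dist x (M.α (p k)) ≤ (1 / 2) ^ k :=
  le_of_tendsto (h.2.dist tendsto_const_nhds)
    (eventually_atTop.2 ⟨k, fun n hn => (h.1 k n hn).le⟩)

-- Index 0 thus serves as the dummy entry of negative names.
@[simp] theorem ratBall_zero (M : ComputableMetric X) : M.ratBall 0 = ∅ := by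
  simp [ratBall, ratOf_zero]

theorem exists_ratBall_subset (M : ComputableMetric X) {U : Set X} (hU : IsOpen U) {x : X}
    (hx : x ∈ U) : ∃ b, x ∈ M.ratBall b ∧ M.ratBall b ⊆ U := by
  obtain ⟨ε, hε, hεU⟩ := Metric.isOpen_iff.1 hU x hx
  obtain ⟨n, hn⟩ := M.dense.exists_dist_lt x (half_pos hε)
  obtain ⟨q, hq1, hq2⟩ := exists_rat_btwn hn
  obtain ⟨k, rfl⟩ := ratOf_surjective q
  refine ⟨Nat.pair n k, by simpa [ratBall] using hq1, fun y hy => hεU ?_⟩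
  simp only [ratBall, Nat.unpair_pair, Metric.mem_ball] at hy ⊢
  have := dist_triangle_right y x (M.α n)
  linarith

/-- In a perfect space a nonempty open set is not exhausted by finitely many points. -/
theorem _root_.IsOpen.diff_finite_nonempty {Y : Type*} [TopologicalSpace Y] [T1Space Y]
    [PerfectSpace Y] {U F : Set Y} (hU : IsOpen U) (hne : U.Nonempty) (hF : F.Finite) :
    (U \ F).Nonempty := by
  obtain ⟨x, hx⟩ := hne
  exact ((infinite_of_mem_nhds x (hU.mem_nhds hx)).sdiff hF).nonempty

/-- Deleting finitely many points from a nonempty open set leaves a nonempty open set, by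
perfectness. Indices can therefore be taken arbitrarily late. -/
theorem exists_ge_mem_of_isOpen [PerfectSpace X] (M : ComputableMetric X) {U : Set X}
    (hU : IsOpen U) (hne : U.Nonempty) (N : ℕ) : ∃ n ≥ N, M.α n ∈ U := by
  have hfin : (M.α '' Set.Iio N).Finite := (Set.finite_Iio N).image _
  obtain ⟨n, hn⟩ := M.dense.exists_mem_open (hU.sdiff hfin.isClosed)
    (hU.diff_finite_nonempty hne hfin)
  exact ⟨n, not_lt.1 fun h => hn.2 ⟨n, h, rfl⟩, hn.1⟩

/-! ### Shrinking balls and nowhere dense sets of avoiding points -/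

/-- The radius of the `n`-th ball of a sequence of rapidly shrinking balls around the points of
the dense sequence. -/
noncomputable def radius (n : ℕ) : ℝ := (1 / 2) ^ (3 * n + 1)

theorem radius_pos (n : ℕ) : 0 < radius n := by
  unfold radius
  positivity

theorem radius_eq (n : ℕ) : radius n = ratOf (halfPowCode (3 * n + 1)) := by
  simp [radius, ratOf_halfPowCode]

theorem radius_antitone : Antitone radius := fun m n h =>
  pow_le_pow_of_le_one (by norm_num) (by norm_num) (by omega)

theorem radius_le_of_lt {m n : ℕ} (h : m < n) : radius n ≤ radius m / 8 := by
  refine (radius_antitone (Nat.succ_le_of_lt h)).trans_eq ?_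
  simp only [radius, Nat.succ_eq_add_one]
  ring

theorem tendsto_radius : Tendsto radius atTop (𝓝 0) :=
  (tendsto_pow_atTop_nhds_zero_of_lt_one (r := (1 / 2 : ℝ)) (by norm_num) (by norm_num)).comp
    (tendsto_atTop_mono (fun n => by omega : ∀ n, n ≤ 3 * n + 1) tendsto_id)

/-- Although the radius is tied to the index of the centre, these balls still form a π-base: late
indices occur near every point. -/
theorem exists_ball_radius_subset [PerfectSpace X] (M : ComputableMetric X) {U : Set X}
    (hU : IsOpen U) (hne : U.Nonempty) (N : ℕ) :
    ∃ n ≥ N, Metric.ball (M.α n) (radius n) ⊆ U := by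
  obtain ⟨x, hx⟩ := hne
  obtain ⟨ε, hε, hεU⟩ := Metric.isOpen_iff.1 hU x hx
  obtain ⟨N', hN'⟩ := (tendsto_radius.eventually_lt_const (half_pos hε)).exists_forall_of_atTop
  obtain ⟨n, hn, hnx⟩ := M.exists_ge_mem_of_isOpen Metric.isOpen_ball
    ⟨x, Metric.mem_ball_self (half_pos hε)⟩ (max N N')
  refine ⟨n, (le_max_left _ _).trans hn, (Metric.ball_subset_ball' ?_).trans hεU⟩
  have := hN' n ((le_max_right _ _).trans hn)
  rw [Metric.mem_ball] at hnx
  linarith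

/-- A decidable relation between `dist (α n) (α g) < radius g / 4` and
`dist (α n) (α g) < radius g / 2`. -/
def Inner (M : ComputableMetric X) (n g : ℕ) : Prop :=
  M.CloseAt (3 * g + 4) n g (halfPowCode (3 * g + 2))

theorem Inner.dist_lt {n g : ℕ} (h : M.Inner n g) : dist (M.α n) (M.α g) < radius g / 2 := by
  have h1 := CloseAt.dist_lt h
  rw [ratOf_halfPowCode] at h1
  push_cast at h1
  have h2 : (1 / 2 : ℝ) ^ (3 * g + 2) = radius g / 2 := by
    unfold radius
    ring
  linarith

theorem inner_of_dist_lt {n g : ℕ} (h : dist (M.α n) (M.α g) < radius g / 4) : M.Inner n g := by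
  refine closeAt_of_dist_add_lt ?_
  rw [ratOf_halfPowCode]
  push_cast
  have h2 : (1 / 2 : ℝ) ^ (3 * g + 2) = radius g / 2 := by
    unfold radius
    ring
  have h3 : 2 * (1 / 2 : ℝ) ^ (3 * g + 4) = radius g / 4 := by
    unfold radius
    ring
  linarith

/-- The centre is off by less than half of the larger radius, and a later ball has at most an eighth
of that radius. -/
theorem Inner.ball_subset {n g : ℕ} (h : M.Inner n g) (hgn : g ≤ n) :
    Metric.ball (M.α n) (radius n) ⊆ Metric.ball (M.α g) (radius g) := by
  rcases hgn.eq_or_lt with rfl | hlt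
  · rfl
  · refine Metric.ball_subset_ball' ?_
    have := h.dist_lt
    have := radius_le_of_lt hlt
    have := radius_pos g
    linarith

/-- Let `W k g` certify that the `k`-th ball is contained in the dense open set `U`. The closure of
the points `α n` that avoid all certified subballs `g ≤ n` is nowhere dense and covers the
complement of `U`. Whether `α n` belongs to this set depends on finitely many certificates only. -/
theorem nowhereDense_closure_avoiding [PerfectSpace X] (M : ComputableMetric X) {U : Set X}
    (hU : Dense U) {W : ℕ → ℕ → Prop}
    (hWU : ∀ k g, W k g → Metric.closedBall (M.α k) (radius k) ⊆ U)
    (hmono : ∀ k g g', g ≤ g' → W k g → W k g')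
    (hW : ∀ O, IsOpen O → (O ∩ U).Nonempty →
      ∃ k g, W k g ∧ Metric.ball (M.α k) (radius k) ⊆ O) :
    let C := closure {x | ∃ n, (∀ g ≤ n, M.Inner n g → ¬ ∃ k < g, M.Inner g k ∧ W k g) ∧ M.α n = x}
    Uᶜ ⊆ C ∧ interior C = ∅ := by
  intro C
  constructor
  · intro x hx
    refine Metric.mem_closure_iff.2 fun ε hε => ?_
    obtain ⟨N, hN⟩ := (tendsto_radius.eventually_lt_const (half_pos hε)).exists_forall_of_atTop
    -- The certified balls too large for a centre to be within `ε / 2` of its points. They are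
    -- finitely many closed balls inside `U`, so `x` can be approximated outside of them.
    set F : Set X := ⋃ k ∈ {k | k < N ∧ ∃ g, W k g}, Metric.closedBall (M.α k) (radius k) with hF
    have hFc : IsClosed F := Set.Finite.isClosed_biUnion
      ((Set.finite_Iio N).subset fun k hk => hk.1) fun k _ => Metric.isClosed_closedBall
    have hxF : x ∉ F := by
      simp only [hF, Set.mem_iUnion, not_exists]
      rintro k ⟨_, g, hg⟩ hxk
      exact hx (hWU k g hg hxk)
    obtain ⟨n, hnx, hnF⟩ := M.dense.exists_mem_open (Metric.isOpen_ball.sdiff hFc)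
      ⟨x, Metric.mem_ball_self (half_pos hε), hxF⟩
    rw [Metric.mem_ball, dist_comm] at hnx
    by_cases hgood : ∀ g ≤ n, M.Inner n g → ¬ ∃ k < g, M.Inner g k ∧ W k g
    · exact ⟨M.α n, ⟨n, hgood, rfl⟩, by linarith⟩
    push Not at hgood
    obtain ⟨g, hgn, hng, k, hkg, hgk, hk⟩ := hgood
    classical
    -- If `α n` is rejected, it is replaced by the centre of the certified ball of least index
    -- around it. A rejection of that centre would produce a certified ball around `α n` of smaller
    -- index.
    have hex : ∃ k, M.α n ∈ Metric.ball (M.α k) (radius k) ∧ ∃ g, W k g :=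
      ⟨k, hgk.ball_subset hkg.le (hng.ball_subset hgn (Metric.mem_ball_self (radius_pos n))), g, hk⟩
    obtain ⟨hkn, g', hg'⟩ := Nat.find_spec hex
    have hmin : ∀ k' < Nat.find hex, _ := fun k' h => Nat.find_min hex h
    set k₀ := Nat.find hex
    refine ⟨M.α k₀, ⟨k₀, ?_, rfl⟩, ?_⟩
    · rintro g hg hin ⟨k', hk'g, hin', hW'⟩
      exact hmin k' (hk'g.trans_le hg)
        ⟨hin'.ball_subset hk'g.le (hin.ball_subset hg hkn), g, hW'⟩
    · have hk₀ : N ≤ k₀ := by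
        by_contra! h
        refine hnF ?_
        simp only [hF, Set.mem_iUnion]
        exact ⟨k₀, ⟨h, g', hg'⟩, Metric.ball_subset_closedBall hkn⟩
      have h1 := hN k₀ hk₀
      rw [Metric.mem_ball] at hkn
      have := dist_triangle x (M.α n) (M.α k₀)
      linarith
  · refine Set.eq_empty_iff_forall_notMem.2 fun y hy => ?_
    obtain ⟨k, g, hk, hkO⟩ := hW (interior C) isOpen_interior
      (hU.inter_open_nonempty _ isOpen_interior ⟨y, hy⟩)
    -- A subball whose index `h` exceeds `k` and is at least `g` rejects every nearby point of index
    -- at least `h`. The finitely many earlier points are cut out of the neighbourhood.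
    obtain ⟨h, hh, hhk⟩ := M.exists_ge_mem_of_isOpen (U := Metric.ball (M.α k) (radius k / 4))
      Metric.isOpen_ball ⟨_, Metric.mem_ball_self (by linarith [radius_pos k])⟩ (max (k + 1) g)
    have hkh : k < h := (le_max_left _ _).trans hh
    have hin : M.Inner h k := inner_of_dist_lt hhk
    have hfin : (M.α '' Set.Iio h).Finite := (Set.finite_Iio h).image _
    have hop : IsOpen (Metric.ball (M.α h) (radius h / 4) \ M.α '' Set.Iio h) :=
      Metric.isOpen_ball.sdiff hfin.isClosed
    obtain ⟨z, hz⟩ := Metric.isOpen_ball.diff_finite_nonempty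
      ⟨M.α h, Metric.mem_ball_self (by linarith [radius_pos h] : 0 < radius h / 4)⟩ hfin
    have hzC : z ∈ C := by
      refine interior_subset (hkO (hin.ball_subset hkh.le ?_))
      exact Metric.ball_subset_ball (by linarith [radius_pos h]) hz.1
    obtain ⟨_, ⟨hnh, hn'⟩, n, hn, rfl⟩ := mem_closure_iff.1 hzC _ hop hz
    refine hn h (not_lt.1 fun hlt => hn' ⟨n, hlt, rfl⟩) (inner_of_dist_lt hnh) ⟨k, hkh, hin, ?_⟩
    exact hmono k g h ((le_max_right _ _).trans hh) hk

end ComputableMetric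
-- Limits, cluster points and closures in terms of names
/-- Coordinatewise description of the limits in the jump of a representation. -/
theorem tendsto_baire_iff {p q : Baire} :
    Tendsto (fun i : ℕ => (fun j => p (Nat.pair i j) : Baire)) atTop (𝓝 q) ↔
      ∀ j, ∀ᶠ i in atTop, p (Nat.pair i j) = q j := by
  simp only [tendsto_pi_nhds, nhds_discrete, tendsto_pure]

theorem mapClusterPt_nat_iff {x : ℕ → ℕ} {n : ℕ} :
    MapClusterPt n atTop x ↔ ∃ᶠ s in atTop, x s = n := by
  simp only [mapClusterPt_iff_frequently, nhds_discrete, mem_pure]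
  exact ⟨fun h => h {n} rfl, fun h s hs => h.mono fun i hi => hi ▸ hs⟩

/-- Since the left summand is open, entries equal to `∞` contribute nothing. -/
theorem mem_inl_preimage_closure_range_iff {X : Type*} [TopologicalSpace X] {x : ℕ → X ⊕ Unit}
    {y : X} : y ∈ Sum.inl ⁻¹' closure (Set.range x) ↔
      ∀ U, IsOpen U → y ∈ U → ∃ k, ∃ z ∈ U, x k = Sum.inl z := by
  rw [Set.mem_preimage, mem_closure_iff]
  constructor
  · intro h U hU hy
    obtain ⟨_, ⟨z, hz, rfl⟩, k, hk⟩ := h (Sum.inl '' U) (isOpenMap_inl U hU) ⟨y, hy, rfl⟩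
    exact ⟨k, z, hz, hk⟩
  · intro h O hO hy
    obtain ⟨k, z, hz, hk⟩ := h _ (hO.preimage continuous_inl) hy
    exact ⟨Sum.inl z, hz, k, hk⟩

namespace ComputableMetric

open TotalRecursive

variable {X : Type*} [MetricSpace X]

/-! ### Negative information is limit computable from positive information -/

open Classical in
/-- The `S`-th approximation of a negative name of the `l`-th set lists the `b`-th ball at
position `b` unless one of the enumerated points has been found in it by stage `S`. -/
noncomputable def negativeInfo (M : ComputableMetric X) (p : Baire) : Baire := fun n =>
  if ∃ k < n.unpair.1, ∃ m < n.unpair.1,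
      p (Nat.pair n.unpair.2.unpair.1 (Nat.pair k 0)) = 0 ∧
      -- Position 0 holds the tag of the summand, so position `m + 2` is entry `m + 1` of the Cauchy
      -- name. Its error `2^(-(m+1))` matches the slack left by `CloseAt` at precision `m`.
      M.CloseAt m (p (Nat.pair n.unpair.2.unpair.1 (Nat.pair k (m + 2))))
        n.unpair.2.unpair.2.unpair.1 n.unpair.2.unpair.2.unpair.2
  then 0 else n.unpair.2.unpair.2

theorem totalRecursive_negativeInfo (M : ComputableMetric X) :
    TotalRecursive M.negativeInfo := by
  have n : TotalRecursive fun (_ : Baire) (x : (ℕ × ℕ) × ℕ) => x.1.1 := id.fst.fst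
  have k : TotalRecursive fun (_ : Baire) (x : (ℕ × ℕ) × ℕ) => x.1.2 := id.fst.snd
  have m : TotalRecursive fun (_ : Baire) (x : (ℕ × ℕ) × ℕ) => x.2 := id.snd
  have l := n.unpairSnd.unpairFst
  have b := n.unpairSnd.unpairSnd
  unfold negativeInfo
  refine TotalRecursivePred.ite ?_ (const 0) id.unpairSnd.unpairSnd
  refine .exists_lt id.unpairFst ?_
  refine .exists_lt id.fst.unpairFst ?_
  refine .and (.eq (l.natPair (k.natPair (const 0))).query (const 0)) ?_
  exact M.totalRecursivePred_closeAt m (l.natPair (k.natPair (m.add (const 2)))).query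
    b.unpairFst b.unpairSnd

/-- Each entry changes at most once along the stages, from the ball to the dummy 0, so the limit
exists. -/
theorem negativeInfo_name (M : ComputableMetric X) {p : Baire}
    {A : ℕ → TopologicalSpace.Closeds X} (h : M.psiPlus.seq.name p A) :
    M.psiMinus.seq.jump.name (M.negativeInfo p) A := by
  classical
  choose x hx hA using h
  let hit : ℕ → ℕ → ℕ → ℕ → Prop := fun l b k m => p (Nat.pair l (Nat.pair k 0)) = 0 ∧
    M.CloseAt m (p (Nat.pair l (Nat.pair k (m + 2)))) b.unpair.1 b.unpair.2
  have hit_iff : ∀ l b, (∃ k m, hit l b k m) ↔ ∃ k, ∃ z ∈ M.ratBall b, x l k = Sum.inl z := by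
    intro l b
    refine exists_congr fun k => ?_
    have hk := hx l k
    cases hz : x l k with
    | inr u =>
      rw [hz] at hk
      simp only [reduceCtorEq, and_false, exists_false, iff_false, not_exists]
      exact fun m hm => hk.1 hm.1
    | inl z =>
      rw [hz] at hk
      obtain ⟨h0, hc⟩ := hk
      have hc' := dist_le_of_cauchy_name hc
      simp only [Sum.inl.injEq, exists_eq_right']
      constructor
      · rintro ⟨m, -, hm⟩
        have h1 := hm.dist_add_lt
        have h2 := hc' (m + 1)
        have h3 := dist_triangle z (M.α (p (Nat.pair l (Nat.pair k (m + 2))))) (M.α b.unpair.1)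
        simp only [ratBall, Metric.mem_ball]
        simp only [add_assoc, Nat.reduceAdd] at h2
        linarith
      · intro hz
        simp only [ratBall, Metric.mem_ball] at hz
        -- The name contributes an error `2^(-m) / 2` and the certificate needs a margin `2 *
        -- 2^(-m)`, together below `3 * 2^(-m)`.
        obtain ⟨m, hm⟩ := exists_pow_lt_of_lt_one
          (div_pos (sub_pos.2 hz) (by norm_num : (0 : ℝ) < 3)) (by norm_num : (1 / 2 : ℝ) < 1)
        refine ⟨m, h0, closeAt_of_dist_add_lt ?_⟩
        have h2 := hc' (m + 1)
        have h3 := dist_triangle_left (M.α (p (Nat.pair l (Nat.pair k (m + 2)))))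
          (M.α b.unpair.1) z
        have h4 : (1 / 2 : ℝ) ^ (m + 1) = (1 / 2) ^ m / 2 := by ring
        have h5 : (0 : ℝ) < (1 / 2) ^ m := by positivity
        simp only [add_assoc, Nat.reduceAdd] at h2
        rw [lt_div_iff₀ (by norm_num)] at hm
        linarith
  refine ⟨fun n => if ∃ k m, hit n.unpair.1 n.unpair.2 k m then 0 else n.unpair.2,
    tendsto_baire_iff.2 fun n => ?_, fun l => ?_⟩
  · by_cases hn : ∃ k m, hit n.unpair.1 n.unpair.2 k m
    · obtain ⟨k, m, hkm⟩ := hn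
      filter_upwards [eventually_gt_atTop (max k m)] with S hS
      rw [if_pos ⟨k, m, hkm⟩, negativeInfo, if_pos]
      simp only [Nat.unpair_pair]
      exact ⟨k, (le_max_left _ _).trans_lt hS, m, (le_max_right _ _).trans_lt hS, hkm⟩
    · refine Eventually.of_forall fun S => ?_
      rw [if_neg hn, negativeInfo, if_neg]
      · simp only [Nat.unpair_pair]
      · simp only [Nat.unpair_pair]
        rintro ⟨k, _, m, _, hkm⟩
        exact hn ⟨k, m, hkm⟩
  · change (A l : Set X) = _
    simp only [Nat.unpair_pair, ← hA, hit_iff]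
    ext y
    rw [mem_inl_preimage_closure_range_iff, Set.mem_compl_iff, Set.mem_iUnion, not_exists]
    constructor
    · intro hy b hb
      split_ifs at hb with hbh
      · simp at hb
      · exact hbh (hy _ Metric.isOpen_ball hb)
    · intro hy U hU hyU
      obtain ⟨b, hb, hbU⟩ := M.exists_ratBall_subset hU hyU
      by_cases hbh : ∃ k, ∃ z ∈ M.ratBall b, x l k = Sum.inl z
      · obtain ⟨k, z, hz, hk⟩ := hbh
        exact ⟨k, z, hbU hz, hk⟩
      · exact absurd hb (by simpa only [if_neg hbh] using hy b)

theorem BCT2_totallyReducible (M : ComputableMetric X) : M.BCT2.TotallyReducible M.BCT0.jump :=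
  ⟨M.negativeInfo, fun q => q, M.totalRecursive_negativeInfo, oracle, fun _ A hp hA =>
    ⟨A, hA, M.negativeInfo_name hp, fun w hw _ hq => ⟨w, hw, hq⟩⟩⟩

theorem BCT3_totallyReducible (M : ComputableMetric X) : M.BCT3.TotallyReducible M.BCT1.jump :=
  ⟨M.negativeInfo, fun q => q, M.totalRecursive_negativeInfo, oracle, fun _ A hp hA =>
    ⟨A, hA, M.negativeInfo_name hp, fun w hw _ hq => ⟨w, hw, hq⟩⟩⟩

/-! ### Positive names from enumerations of points of the dense sequence -/

open Classical in
/-- A positive name of the closures of the sets `{α a | ∃ s, G l a s}`. -/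
noncomputable def enumPoints (G : ℕ → ℕ → ℕ → Prop) : Baire := fun n =>
  if n.unpair.2.unpair.2 = 0 then
    if G n.unpair.1 n.unpair.2.unpair.1.unpair.1 n.unpair.2.unpair.1.unpair.2 then 0 else 1
  else n.unpair.2.unpair.1.unpair.1

theorem totalRecursive_enumPoints {G : Baire → ℕ → ℕ → ℕ → Prop}
    (hG : TotalRecursivePred fun p (x : ℕ × ℕ × ℕ) => G p x.1 x.2.1 x.2.2) :
    TotalRecursive fun p => enumPoints (G p) := by
  obtain ⟨b, hb, h⟩ := hG
  have hG' : TotalRecursivePred fun p (n : ℕ) =>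
      G p n.unpair.1 n.unpair.2.unpair.1.unpair.1 n.unpair.2.unpair.1.unpair.2 :=
    ⟨_, hb.comp (id.unpairFst.pair (id.unpairSnd.unpairFst.unpairFst.pair
      id.unpairSnd.unpairFst.unpairSnd)), fun p a => h _ _⟩
  unfold enumPoints
  exact TotalRecursivePred.ite (.eq id.unpairSnd.unpairSnd (const 0))
    (TotalRecursivePred.ite hG' (const 0) (const 1))
    id.unpairSnd.unpairFst.unpairFst

/-- Entry `⟨a, s⟩` is `α a` if `s` is a witness for `a`, and `∞` otherwise. Any semidecidable set of
points, even the empty one, can be listed in this way. -/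
theorem enumPoints_name (M : ComputableMetric X) (G : ℕ → ℕ → ℕ → Prop) :
    M.psiPlus.seq.name (enumPoints G)
      fun l => TopologicalSpace.Closeds.closure {x | ∃ a, (∃ s, G l a s) ∧ M.α a = x} := by
  classical
  intro l
  refine ⟨fun v => if G l v.unpair.1 v.unpair.2 then Sum.inl (M.α v.unpair.1) else Sum.inr (),
    fun v => ?_, ?_⟩
  · by_cases hv : G l v.unpair.1 v.unpair.2
    · simpa [enumPoints, Representation.coprod, hv] using M.cauchy_const _
    · simp [enumPoints, Representation.coprod, Representation.unit, hv]
  · ext y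
    rw [mem_inl_preimage_closure_range_iff]
    simp only [TopologicalSpace.Closeds.coe_closure, mem_closure_iff]
    refine forall₃_congr fun U hU hy => ⟨?_, ?_⟩
    · rintro ⟨v, z, hz, hv⟩
      split_ifs at hv with hG
      obtain rfl := Sum.inl_injective hv
      exact ⟨_, hz, _, ⟨_, hG⟩, rfl⟩
    · rintro ⟨_, hz, a, ⟨s, hs⟩, rfl⟩
      exact ⟨Nat.pair a s, M.α a, hz, by simp [hs]⟩

/-! ### The cluster point problem reduces to `BCT₃` -/

theorem CLNat_totallyReducible [PerfectSpace X] (M : ComputableMetric X) :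
    CLNat.TotallyReducible M.BCT3 := by
  refine ⟨fun p => enumPoints fun n a s => p (Nat.pair s 0) = n ∧ a ≤ s, fun q => q,
    totalRecursive_enumPoints (.and (.eq (id.snd.snd.natPair (const 0)).query id.fst)
      (.le id.snd.fst id.snd.snd)), oracle, fun p x hp hx => ?_⟩
  have hp' : ∀ i, p (Nat.pair i 0) = x i := hp
  simp only [hp']
  refine ⟨_, ?_, M.enumPoints_name _, fun n hn q hq => ⟨n, ?_, hq⟩⟩
  · obtain ⟨n, hn⟩ := hx
    rw [mapClusterPt_nat_iff] at hn
    refine Set.eq_univ_of_forall fun y => Set.mem_iUnion.2 ⟨n, ?_⟩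
    refine closure_mono ?_ (M.dense y)
    -- A recurring value occurs at some stage beyond each `a`, so all of the dense sequence is
    -- listed.
    rintro _ ⟨a, rfl⟩
    obtain ⟨s, hs, hsn⟩ := Filter.frequently_atTop.1 hn a
    exact ⟨a, ⟨s, hsn, hs⟩, rfl⟩
  · change MapClusterPt n atTop x
    rw [mapClusterPt_nat_iff]
    intro hnot
    obtain ⟨N, hN⟩ := eventually_atTop.1 hnot
    have hfin : {y | ∃ a, (∃ s, x s = n ∧ a ≤ s) ∧ M.α a = y}.Finite := by
      refine ((Set.finite_Iio N).image M.α).subset ?_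
      rintro _ ⟨a, ⟨s, hs, has⟩, rfl⟩
      exact ⟨a, has.trans_lt (not_le.1 fun h => hN s h hs), rfl⟩
    obtain ⟨y, hy, hy'⟩ := isOpen_interior.diff_finite_nonempty
      (Set.nonempty_iff_ne_empty.2 hn) hfin
    exact hy' (hfin.isClosed.closure_subset (interior_subset hy))

/-! ### The jump of `BCT₀` reduces to `BCT₂` -/

/-- At stage `S`, the sequence of approximations of the `i`-th ball of the complement of the `l`-th
set appears to be constant from index `m` on, with a limit that contains the `k`-th ball. -/
def BallInside (M : ComputableMetric X) (p : Baire) (l S k i m : ℕ) : Prop :=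
  M.CloseAt (3 * k) k (p (Nat.pair m (Nat.pair l i))).unpair.1
    (p (Nat.pair m (Nat.pair l i))).unpair.2 ∧
  ∀ s < S, m ≤ s → p (Nat.pair s (Nat.pair l i)) = p (Nat.pair m (Nat.pair l i))

/-- At stage `S`, the `n`-th point appears to avoid all subballs `g ≤ n` of balls that lie in the
complement of the `l`-th set. -/
def Avoids (M : ComputableMetric X) (p : Baire) (l n S : ℕ) : Prop :=
  ∀ g < n + 1, ∀ k < g, ∀ i < g, ∀ m < g,
    ¬ (M.Inner n g ∧ M.Inner g k ∧ M.BallInside p l S k i m)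

theorem totalRecursivePred_inner {α : Type*} [Primcodable α] (M : ComputableMetric X)
    {N G : Baire → α → ℕ} (hN : TotalRecursive N) (hG : TotalRecursive G) :
    TotalRecursivePred fun p x => M.Inner (N p x) (G p x) :=
  M.totalRecursivePred_closeAt (((const 3).mul hG).add (const 4)) hN hG
    (((const 3).mul hG).add (const 2)).halfPowCode

theorem totalRecursivePred_ballInside {α : Type*} [Primcodable α] (M : ComputableMetric X)
    {L S K I N : Baire → α → ℕ} (hL : TotalRecursive L) (hS : TotalRecursive S)
    (hK : TotalRecursive K) (hI : TotalRecursive I) (hN : TotalRecursive N) :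
    TotalRecursivePred fun p x => M.BallInside p (L p x) (S p x) (K p x) (I p x) (N p x) := by
  have hb := (hN.natPair (hL.natPair hI)).query
  refine .and (M.totalRecursivePred_closeAt ((const 3).mul hK) hK hb.unpairFst hb.unpairSnd) ?_
  refine .forall_lt hS ?_
  have lift : ∀ {F : Baire → α → ℕ}, TotalRecursive F →
      TotalRecursive fun p (x : α × ℕ) => F p x.1 := fun hF => hF.comp id.fst
  exact .imp (.le (lift hN) id.snd)
    (.eq (id.snd.natPair ((lift hL).natPair (lift hI))).query (lift hb))

theorem totalRecursivePred_avoids (M : ComputableMetric X) :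
    TotalRecursivePred fun p (x : ℕ × ℕ × ℕ) => M.Avoids p x.1 x.2.1 x.2.2 := by
  unfold Avoids
  refine .forall_lt (id.snd.fst.add (const 1)) ?_
  refine .forall_lt id.snd ?_
  refine .forall_lt id.fst.snd ?_
  refine .forall_lt id.fst.fst.snd ?_
  have x : TotalRecursive fun (_ : Baire) (x : ((((ℕ × ℕ × ℕ) × ℕ) × ℕ) × ℕ) × ℕ) =>
    x.1.1.1.1 := id.fst.fst.fst.fst
  have g : TotalRecursive fun (_ : Baire) (x : ((((ℕ × ℕ × ℕ) × ℕ) × ℕ) × ℕ) × ℕ) =>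
    x.1.1.1.2 := id.fst.fst.fst.snd
  have k : TotalRecursive fun (_ : Baire) (x : ((((ℕ × ℕ × ℕ) × ℕ) × ℕ) × ℕ) × ℕ) =>
    x.1.1.2 := id.fst.fst.snd
  exact .not (.and (M.totalRecursivePred_inner x.snd.fst g) (.and (M.totalRecursivePred_inner g k)
    (M.totalRecursivePred_ballInside x.fst x.snd.snd k id.fst.snd id.snd)))

/-- A certificate that fails at one stage fails at all later ones. Only finitely many are involved,
so a single stage refutes all the false ones. -/
theorem exists_avoids_iff (M : ComputableMetric X) (p : Baire) (l n : ℕ) :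
    (∃ S, M.Avoids p l n S) ↔ ∀ g ≤ n, M.Inner n g →
      ¬ ∃ k < g, M.Inner g k ∧ ∃ i < g, ∃ m < g, ∀ S, M.BallInside p l S k i m := by
  constructor
  · rintro ⟨S, hS⟩ g hg hng ⟨k, hk, hgk, i, hi, m, hm, h⟩
    exact hS g (Nat.lt_succ_of_le hg) k hk i hi m hm ⟨hng, hgk, h S⟩
  · intro h
    have fin : ∀ {g : ℕ} {P : ℕ → ℕ → Prop}, (∀ k < g, ∀ᶠ S in atTop, P k S) →
        ∀ᶠ S in atTop, ∀ k < g, P k S := fun {g P} h =>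
      (eventually_all_finite (Set.finite_Iio g)).2 h
    refine Eventually.exists (f := atTop) (fin fun g hg => fin fun k hk => fin fun i hi =>
      fin fun m hm => ?_)
    by_contra hcon
    refine h g (Nat.le_of_lt_succ hg) ?_ ⟨k, hk, ?_, i, hi, m, hm, fun S => ?_⟩
    · by_contra h'
      exact hcon (.of_forall fun S hS => h' hS.1)
    · by_contra h'
      exact hcon (.of_forall fun S hS => h' hS.2.1)
    · obtain ⟨S', hS', hb⟩ := frequently_atTop.1 hcon S
      have hb := hb.2.2
      exact ⟨hb.1, fun s hs => hb.2 s (hs.trans_le hS')⟩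

theorem BCT0_jump_totallyReducible [PerfectSpace X] (M : ComputableMetric X) :
    M.BCT0.jump.TotallyReducible M.BCT2 := by
  refine ⟨fun p => enumPoints (M.Avoids p), fun q => q,
    totalRecursive_enumPoints M.totalRecursivePred_avoids, oracle, fun p A hp hA => ?_⟩
  obtain ⟨q, hpq, hq⟩ := hp
  rw [tendsto_baire_iff] at hpq
  have key : ∀ l, (A l : Set X) ⊆
        closure {x | ∃ n, (∃ S, M.Avoids p l n S) ∧ M.α n = x} ∧
      interior (closure {x | ∃ n, (∃ S, M.Avoids p l n S) ∧ M.α n = x}) = ∅ := by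
    intro l
    have hql : (A l : Set X) = (⋃ i, M.ratBall (q (Nat.pair l i)))ᶜ := hq l
    simp only [exists_avoids_iff]
    have := M.nowhereDense_closure_avoiding (U := (A l : Set X)ᶜ)
      (W := fun k g => ∃ i < g, ∃ m < g, ∀ S, M.BallInside p l S k i m)
      (interior_eq_empty_iff_dense_compl.1 (hA l)) ?_ ?_ ?_
    · rwa [compl_compl] at this
    · rintro k g ⟨i, -, m, -, h⟩
      -- At a late stage the entry equals its limit; by constancy from `m` on, so does the entry at
      -- stage `m`.
      obtain ⟨s, hs, hms⟩ := ((hpq (Nat.pair l i)).and (eventually_ge_atTop m)).exists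
      have hqm := (h (s + 1)).2 s (Nat.lt_succ_self s) hms
      have hclose := (h 0).1
      rw [← hqm, hs] at hclose
      -- At precision `3 * k` the slack is exactly `radius k`, so the closed ball fits.
      have hd := hclose.dist_add_lt
      rw [hql, compl_compl]
      refine (Metric.closedBall_subset_ball' (ε₂ := ((ratOf (q (Nat.pair l i)).unpair.2 : ℚ) : ℝ))
        ?_).trans (Set.subset_iUnion (fun i => M.ratBall (q (Nat.pair l i))) i)
      rw [add_comm]
      exact hd
    · rintro k g g' hg ⟨i, hi, m, hm, h⟩
      exact ⟨i, hi.trans_le hg, m, hm.trans_le hg, h⟩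
    · rintro O hO ⟨y, hyO, hy⟩
      rw [hql, compl_compl, Set.mem_iUnion] at hy
      obtain ⟨i, hyi⟩ := hy
      obtain ⟨m, hm⟩ := eventually_atTop.1 (hpq (Nat.pair l i))
      simp only [ratBall, Metric.mem_ball] at hyi
      set a := M.α (q (Nat.pair l i)).unpair.1
      set r := ((ratOf (q (Nat.pair l i)).unpair.2 : ℚ) : ℝ)
      set δ := r - dist y a with hδ
      have hδ0 : 0 < δ := sub_pos.2 hyi
      -- The certificate needs a margin `4 * radius k < δ / 2`; the other `δ / 2` pays for the
      -- distance from `α k` to `y`.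
      obtain ⟨N, hN⟩ := (tendsto_radius.eventually_lt_const
        (by linarith : 0 < δ / 8)).exists_forall_of_atTop
      obtain ⟨k, hkN, hk⟩ := M.exists_ball_radius_subset
        (hO.inter (Metric.isOpen_ball (x := y) (ε := δ / 2)))
        ⟨y, hyO, Metric.mem_ball_self (half_pos hδ0)⟩ N
      refine ⟨k, max i m + 1, ⟨i, by omega, m, by omega, fun S => ⟨?_, fun s _ hs => ?_⟩⟩,
        hk.trans Set.inter_subset_left⟩
      · rw [hm m le_rfl]
        refine closeAt_of_dist_add_lt ?_
        have h1 := hN k hkN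
        have h2 : (1 / 2 : ℝ) ^ (3 * k) = 2 * radius k := by
          unfold radius
          ring
        have h3 := (hk (Metric.mem_ball_self (radius_pos k))).2
        rw [Metric.mem_ball] at h3
        have h4 := dist_triangle (M.α k) y a
        rw [h2]
        change dist (M.α k) a + _ < r
        linarith
      · rw [hm m le_rfl, hm s hs]
  -- A point outside the larger sets lies outside the given ones, so the answer is passed on
  -- unchanged.
  exact ⟨_, fun l => (key l).2, M.enumPoints_name _, fun w hw _ hq => ⟨w, fun hwA =>
    hw (Set.iUnion_mono (fun l => (key l).1) hwA), hq⟩⟩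

/-! ### The jump of `BCT₁` reduces to the cluster point problem -/

/-- At stage `s`, no point of the `n`-th ball is found, by searches bounded by `L`, in the first `L`
balls of the complement of the `i`-th set. -/
def BallOutside (M : ComputableMetric X) (p : Baire) (n i L s : ℕ) : Prop :=
  ∀ j < L, ∀ a < L, ∀ t < L, ¬ (M.CloseAt t a n (halfPowCode (3 * n + 1)) ∧
    M.CloseAt t a (p (Nat.pair s (Nat.pair i j))).unpair.1
      (p (Nat.pair s (Nat.pair i j))).unpair.2)

/-- `s` is the first stage from `L` on at which `BallOutside` holds. -/
def FirstOutside (M : ComputableMetric X) (p : Baire) (n i L s : ℕ) : Prop :=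
  L ≤ s ∧ M.BallOutside p n i L s ∧ ∀ s' < s, L ≤ s' → ¬ M.BallOutside p n i L s'

theorem totalRecursivePred_ballOutside {α : Type*} [Primcodable α] (M : ComputableMetric X)
    {N I L S : Baire → α → ℕ} (hN : TotalRecursive N) (hI : TotalRecursive I)
    (hL : TotalRecursive L) (hS : TotalRecursive S) :
    TotalRecursivePred fun p x => M.BallOutside p (N p x) (I p x) (L p x) (S p x) := by
  unfold BallOutside
  have lift : ∀ {β : Type _} [Primcodable β] {F : Baire → β → ℕ}, TotalRecursive F →
      TotalRecursive fun p (x : β × ℕ) => F p x.1 := fun hF => hF.comp id.fst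
  refine .forall_lt hL ?_
  refine .forall_lt (lift hL) ?_
  refine .forall_lt (lift (lift hL)) ?_
  have n := lift (lift (lift hN))
  have j : TotalRecursive fun (_ : Baire) (x : ((α × ℕ) × ℕ) × ℕ) => x.1.1.2 := id.fst.fst.snd
  have b := ((lift (lift (lift hS))).natPair ((lift (lift (lift hI))).natPair j)).query
  exact .not (.and (M.totalRecursivePred_closeAt id.snd id.fst.snd n
    (((const 3).mul n).add (const 1)).halfPowCode)
    (M.totalRecursivePred_closeAt id.snd id.fst.snd b.unpairFst b.unpairSnd))

theorem totalRecursivePred_firstOutside {α : Type*} [Primcodable α] (M : ComputableMetric X)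
    {N I L S : Baire → α → ℕ} (hN : TotalRecursive N) (hI : TotalRecursive I)
    (hL : TotalRecursive L) (hS : TotalRecursive S) :
    TotalRecursivePred fun p x => M.FirstOutside p (N p x) (I p x) (L p x) (S p x) := by
  have lift : ∀ {F : Baire → α → ℕ}, TotalRecursive F →
      TotalRecursive fun p (x : α × ℕ) => F p x.1 := fun hF => hF.comp id.fst
  refine .and (.le hL hS) (.and (M.totalRecursivePred_ballOutside hN hI hL hS) ?_)
  refine .forall_lt hS ?_
  exact .imp (.le (lift hL) id.snd)
    (.not (M.totalRecursivePred_ballOutside (lift hN) (lift hI) (lift hL) id.snd))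

open Classical in
/-- A sequence in which `2 * ⟨n, i⟩` occurs infinitely often if and only if the `n`-th ball is
contained in the `i`-th set, and all odd numbers occur at most once. -/
noncomputable def outsideSeq (M : ComputableMetric X) (p : Baire) (v : ℕ) : ℕ :=
  if M.FirstOutside p v.unpair.1.unpair.1 v.unpair.1.unpair.2 v.unpair.2.unpair.1
      v.unpair.2.unpair.2
  then 2 * v.unpair.1 else 2 * v + 1

theorem totalRecursive_outsideSeq (M : ComputableMetric X) :
    TotalRecursive fun p (n : ℕ) => M.outsideSeq p n.unpair.1 := by
  unfold outsideSeq
  have v : TotalRecursive fun (_ : Baire) (n : ℕ) => (Nat.unpair n).1 := id.unpairFst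
  exact TotalRecursivePred.ite (M.totalRecursivePred_firstOutside v.unpairFst.unpairFst
    v.unpairFst.unpairSnd v.unpairSnd.unpairFst v.unpairSnd.unpairSnd)
    ((const 2).mul v.unpairFst) (((const 2).mul v).add (const 1))

theorem FirstOutside.unique {M : ComputableMetric X} {p : Baire} {n i L s s' : ℕ}
    (h : M.FirstOutside p n i L s) (h' : M.FirstOutside p n i L s') : s = s' :=
  le_antisymm (not_lt.1 fun hlt => h.2.2 s' hlt h'.1 h'.2.1)
    (not_lt.1 fun hlt => h'.2.2 s hlt h.1 h.2.1)

/-- For each `L`, the first `L` entries eventually agree with their limits, and then no search can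
succeed. Hence each `L` contributes a position `v ≥ L`. -/
theorem frequently_outsideSeq_eq {M : ComputableMetric X} {p q : Baire} {A : Set X} {n i : ℕ}
    (hpq : ∀ j, ∀ᶠ s in atTop, p (Nat.pair s j) = q j)
    (hA : A = (⋃ j, M.ratBall (q (Nat.pair i j)))ᶜ)
    (hn : Metric.ball (M.α n) (radius n) ⊆ A) :
    ∃ᶠ v in atTop, M.outsideSeq p v = 2 * Nat.pair n i := by
  classical
  refine frequently_atTop.2 fun L => ?_
  have hev : ∀ᶠ s in atTop, ∀ j < L, p (Nat.pair s (Nat.pair i j)) = q (Nat.pair i j) :=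
    (eventually_all_finite (Set.finite_Iio L)).2 fun j _ => hpq _
  have hex : ∃ s, L ≤ s ∧ M.BallOutside p n i L s := by
    obtain ⟨s, hs, hLs⟩ := (hev.and (eventually_ge_atTop L)).exists
    refine ⟨s, hLs, fun j hj a _ t _ ⟨h1, h2⟩ => ?_⟩
    rw [hs j hj] at h2
    have h1' := h1.dist_lt
    rw [← radius_eq] at h1'
    have h3 : M.α a ∈ A := hn h1'
    rw [hA] at h3
    exact h3 (Set.mem_iUnion.2 ⟨j, h2.dist_lt⟩)
  refine ⟨Nat.pair (Nat.pair n i) (Nat.pair L (Nat.find hex)),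
    (Nat.left_le_pair _ _).trans (Nat.right_le_pair _ _), ?_⟩
  rw [outsideSeq, if_pos]
  · simp
  · simp only [Nat.unpair_pair]
    exact ⟨(Nat.find_spec hex).1, (Nat.find_spec hex).2, fun s' hs' hL h =>
      Nat.find_min hex hs' ⟨hL, h⟩⟩

/-- A point of the ball outside `A` yields a dense point witnessing this, which bounded searches
find once `L` is large. Only finitely many `L` remain, with at most one stage each. Using `c / 2`
treats odd values along with even ones. -/
theorem ball_subset_of_frequently_outsideSeq {M : ComputableMetric X} {p q : Baire} {A : Set X}
    {c n i : ℕ} (hpq : ∀ j, ∀ᶠ s in atTop, p (Nat.pair s j) = q j)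
    (hA : A = (⋃ j, M.ratBall (q (Nat.pair i j)))ᶜ)
    (hc : ∃ᶠ v in atTop, M.outsideSeq p v = c) (hni : c / 2 = Nat.pair n i) :
    Metric.ball (M.α n) (radius n) ⊆ A := by
  intro y hy
  by_contra hyA
  rw [hA, Set.notMem_compl_iff, Set.mem_iUnion] at hyA
  obtain ⟨j, hyj⟩ := hyA
  obtain ⟨a, ha, haj⟩ := M.dense.exists_mem_open (Metric.isOpen_ball.inter Metric.isOpen_ball)
    ⟨y, hy, hyj⟩
  rw [Metric.mem_ball, radius_eq] at ha
  obtain ⟨t, ht, htj⟩ := ((eventually_closeAt ha).and (eventually_closeAt haj)).exists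
  obtain ⟨s₀, hs₀⟩ := eventually_atTop.1 (hpq (Nat.pair i j))
  set B := max s₀ (max j (max a t) + 1) with hB
  -- The condition `L ≤ s` forces the stage past `s₀`, where the `j`-th ball has reached its limit.
  have hbound : ∀ L s, M.FirstOutside p n i L s → L < B := by
    intro L s h
    by_contra! hL
    refine h.2.1 j (by omega) a (by omega) t (by omega) ⟨ht, ?_⟩
    rw [hs₀ s (by have := h.1; omega)]
    exact htj
  refine Nat.frequently_atTop_iff_infinite.1 hc (Set.Finite.subset
    (s := {c / 2} ∪ ⋃ L ∈ Set.Iio B, {v | v.unpair.1 = Nat.pair n i ∧ v.unpair.2.unpair.1 = L ∧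
      M.FirstOutside p n i L v.unpair.2.unpair.2}) ?_ ?_)
  · refine (Set.finite_singleton _).union ((Set.finite_Iio B).biUnion fun L _ =>
      Set.Subsingleton.finite ?_)
    rintro v ⟨h1, h2, h3⟩ w ⟨h1', h2', h3'⟩
    rw [← Nat.pair_unpair v, ← Nat.pair_unpair w, h1, h1', ← Nat.pair_unpair v.unpair.2,
      ← Nat.pair_unpair w.unpair.2, h2, h2', h3.unique h3']
  · intro v hv
    rw [Set.mem_ofPred_eq, outsideSeq] at hv
    split_ifs at hv with hf
    · have hv1 : v.unpair.1 = Nat.pair n i := by omega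
      rw [hv1, Nat.unpair_pair] at hf
      exact Or.inr (Set.mem_biUnion (hbound _ _ hf) ⟨hv1, rfl, hf⟩)
    · exact Or.inl (show v = c / 2 by omega)

theorem BCT1_jump_totallyReducible [CompleteSpace X] [PerfectSpace X] (M : ComputableMetric X) :
    M.BCT1.jump.TotallyReducible CLNat := by
  have : Nonempty X := ⟨M.α 0⟩
  refine ⟨fun p n => M.outsideSeq p n.unpair.1, fun q _ => (q 0 / 2).unpair.2,
    M.totalRecursive_outsideSeq, ((const 0).query.div (const 2)).unpairSnd, fun p A hp hA => ?_⟩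
  obtain ⟨q, hpq, hq⟩ := hp
  rw [tendsto_baire_iff] at hpq
  refine ⟨M.outsideSeq p, ?_, fun v => by simp [Representation.nat], ?_⟩
  · obtain ⟨i, hi⟩ := nonempty_interior_of_iUnion_of_closed (fun i => (A i).isClosed) hA
    obtain ⟨n, -, hn⟩ := M.exists_ball_radius_subset isOpen_interior hi 0
    exact ⟨2 * Nat.pair n i, mapClusterPt_nat_iff.2
      (frequently_outsideSeq_eq hpq (hq i) (hn.trans interior_subset))⟩
  · rintro c hc r rfl
    refine ⟨(r 0 / 2).unpair.2, ?_, rfl⟩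
    have hsub := ball_subset_of_frequently_outsideSeq hpq (hq _) (mapClusterPt_nat_iff.1 hc)
      (Nat.pair_unpair (r 0 / 2)).symm
    exact Set.nonempty_iff_ne_empty.1 ⟨_, interior_maximal hsub Metric.isOpen_ball
      (Metric.mem_ball_self (radius_pos _))⟩

end ComputableMetric

end CompAnalysis

theorem theorem4p3 {X : Type*} [MetricSpace X] [CompleteSpace X] [PerfectSpace X]
    (M : CompAnalysis.ComputableMetric X) :
    M.BCT0.jump ≡sW M.BCT2 ∧ M.BCT1.jump ≡sW M.BCT3 ∧ M.BCT3 ≡sW CompAnalysis.CLNat :=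
  ⟨⟨M.BCT0_jump_totallyReducible.strongReducible, M.BCT2_totallyReducible.strongReducible⟩,
    ⟨(M.BCT1_jump_totallyReducible.trans M.CLNat_totallyReducible).strongReducible,
      M.BCT3_totallyReducible.strongReducible⟩,
    ⟨(M.BCT3_totallyReducible.trans M.BCT1_jump_totallyReducible).strongReducible,
      M.CLNat_totallyReducible.strongReducible⟩⟩
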